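/- Let $B$ be a binary tree on $n \ge 1$ vertices, that is, a finite tree in which every vertex has degree at most $3$ (equivalently, a finite tree that can be rooted so that every vertex has at most two children). Let $\chi_p(B)$ be its parity vertex chromatic number: the least $k$ for which there is a colouring $c : V(B) \to \{1,\dots,k\}$ such that on every (nonempty) path of $B$, one-vertex paths included, some colour occurs an odd number of times. Then $$\chi_p(B) > \sqrt[3]{\log_2 n}.$$ -/

import Mathlib

/-- A colouring `c` of the vertices of `G` is a parity vertex colouring if on every (nonempty)
path of `G`, the one-vertex paths included, some colour occurs an odd number of times. -/
def IsParityVertexColouring {V : Type*} (G : SimpleGraph V) {k : ℕ} (c : V → Fin k) : Prop :=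
  ∀ (u v : V) (p : G.Walk u v), p.IsPath → ∃ i : Fin k, Odd ((p.support.map c).count i)

/-- The parity vertex chromatic number: the least number of colours in a parity vertex colouring.
For a finite graph the set below is nonempty, see `exists_isParityVertexColouring`. -/
noncomputable def parityChromaticNumber {V : Type*} (G : SimpleGraph V) : ℕ :=
  sInf {k : ℕ | ∃ c : V → Fin k, IsParityVertexColouring G c}

/-- On a finite graph, giving all vertices distinct colours is a parity vertex colouring. -/
theorem exists_isParityVertexColouring {V : Type*} [Fintype V] (G : SimpleGraph V) :
    {k : ℕ | ∃ c : V → Fin k, IsParityVertexColouring G c}.Nonempty := by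
  refine ⟨Fintype.card V, Fintype.equivFin V, ?_⟩
  intro u v p hp
  refine ⟨Fintype.equivFin V u, ?_⟩
  rw [List.count_eq_one_of_mem (hp.support_nodup.map (Fintype.equivFin V).injective)
    (List.mem_map_of_mem p.start_mem_support)]
  exact odd_one

/-- A binary tree (without a distinguished root): a tree in which every vertex has at most three
neighbours. For finite trees this says exactly that the tree can be rooted so that every vertex
has at most two sons: root it in a leaf, or in its only vertex. -/
def IsBinaryTree {V : Type*} (G : SimpleGraph V) : Prop :=
  G.IsTree ∧ ∀ v : V, (G.neighborSet v).encard ≤ 3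

open Finset

/-! Root `B` at a vertex of degree at most two and give each path its parity vector in `(ZMod 2)^k`;
in a parity colouring no path has vector zero. For each colour `i`, the paths from the root to the
nodes of a complete binary tree of colour `i` have distinct vectors (`exists_mono_subset`). Hence
that tree has height at most `k`, and the heights over all colours sum to at most `k ^ 2`. Passing
from a node to a child lowers the number of root vectors, and for at least one child also this sum.
Induction (`numNodes_succ_le_pow`) then gives `n < (2 ^ k) ^ (k ^ 2)`. -/

namespace ParityColouring

/-! ### Binary trees with coloured nodes -/

section BinaryTree

variable {k : ℕ}

/-- The parity vector of a single vertex of colour `i`. -/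
def unit (i : Fin k) : Fin k → ZMod 2 := Pi.single i 1

theorem parityVector_add_self (x : Fin k → ZMod 2) : x + x = 0 :=
  funext fun i ↦ CharTwo.add_self_eq_zero (x i)

/-- The parity vectors of the downward paths that start in the root. -/
def rootSums : BinaryTree (Fin k) → Finset (Fin k → ZMod 2)
  | .nil => ∅
  | .node i l r => insert (unit i) ((rootSums l ∪ rootSums r).image (unit i + ·))

theorem mem_rootSums_node {i : Fin k} {l r : BinaryTree (Fin k)} {x : Fin k → ZMod 2} :
    x ∈ rootSums (.node i l r) ↔
      x = unit i ∨ ∃ y, (y ∈ rootSums l ∨ y ∈ rootSums r) ∧ unit i + y = x := by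
  simp only [rootSums, mem_insert, mem_image, mem_union]

/-- No path of the coloured binary tree has parity vector zero. -/
def IsParity : BinaryTree (Fin k) → Prop
  | .nil => True
  | .node i l r => IsParity l ∧ IsParity r ∧ 0 ∉ rootSums (.node i l r) ∧
      ∀ x ∈ rootSums l, ∀ y ∈ rootSums r, x + unit i + y ≠ 0

theorem IsParity.zero_notMem {t : BinaryTree (Fin k)} (ht : IsParity t) : 0 ∉ rootSums t := by
  cases t with
  | nil => simp [rootSums]
  | node i l r => exact ht.2.2.1

/-- The height of a largest complete binary tree that embeds, with respect to least common
ancestors, into the nodes of colour `i`. -/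
def monoRank (i : Fin k) : BinaryTree (Fin k) → ℕ
  | .nil => 0
  | .node j l r =>
      if j = i ∧ monoRank i l = monoRank i r then monoRank i l + 1
      else max (monoRank i l) (monoRank i r)

theorem monoRank_left_le (i j : Fin k) (l r : BinaryTree (Fin k)) :
    monoRank i l ≤ monoRank i (.node j l r) := by
  rw [monoRank]; split_ifs <;> omega

theorem monoRank_right_le (i j : Fin k) (l r : BinaryTree (Fin k)) :
    monoRank i r ≤ monoRank i (.node j l r) := by
  rw [monoRank]; split_ifs <;> omega

/-- Equal ranks below a root of colour `i` push its rank above both; unequal ones leave the smaller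
strictly below the maximum. -/
theorem monoRank_root_lt (i : Fin k) (l r : BinaryTree (Fin k)) :
    monoRank i l < monoRank i (.node i l r) ∨ monoRank i r < monoRank i (.node i l r) := by
  rw [monoRank]; split_ifs <;> grind

theorem card_rootSums_node {i : Fin k} {l r : BinaryTree (Fin k)}
    (ht : IsParity (.node i l r)) :
    #(rootSums (.node i l r)) = #(rootSums l ∪ rootSums r) + 1 := by
  rw [rootSums, card_insert_of_notMem, card_image_of_injective _ (add_right_injective _)]
  simp only [mem_image, mem_union, not_exists, not_and, add_eq_left]
  rintro x hx rfl
  exact hx.elim ht.1.zero_notMem ht.2.1.zero_notMem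

theorem card_rootSums_lt {t : BinaryTree (Fin k)} (ht : IsParity t) :
    #(rootSums t) + 1 ≤ 2 ^ k := by
  have h := card_le_univ (insert 0 (rootSums t))
  rw [card_insert_of_notMem ht.zero_notMem] at h
  simpa [ZMod.card] using h

/-- The paths from the root to the nodes of a complete binary tree of colour `i` have distinct
parity vectors. The last condition, about the paths without their last node, serves the induction. -/
theorem exists_mono_subset (i : Fin k) (t : BinaryTree (Fin k)) (ht : IsParity t) :
    ∃ E ⊆ rootSums t, 2 ^ monoRank i t ≤ #E + 1 ∧
      ∀ x ∈ E, unit i + x = 0 ∨ unit i + x ∈ rootSums t := by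
  induction t with
  | nil => exact ⟨∅, by simp [monoRank]⟩
  | node j l r ihl ihr =>
    obtain ⟨E, hE, hEcard, hEi⟩ := ihl ht.1
    obtain ⟨F, hF, hFcard, hFi⟩ := ihr ht.2.1
    have shift (x) (hx : unit i + x = 0 ∨ unit i + x ∈ rootSums l ∨ unit i + x ∈ rootSums r) :
        unit i + (unit j + x) ∈ rootSums (.node j l r) := by
      rw [add_left_comm, mem_rootSums_node]
      rcases hx with hx | hx
      · simp [hx]
      · exact .inr ⟨_, hx, rfl⟩
    by_cases hji : j = i
    · subst hji
      have hdisj : Disjoint E F := by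
        rw [disjoint_left]
        intro x hxE hxF
        -- Were `x` shared, drop the last node of the left path and continue through the root, which
        -- has the same colour, into the right path: the resulting path has vector `x + x = 0`.
        rcases hEi x hxE with h | h
        · exact ht.zero_notMem (mem_rootSums_node.2 (.inr ⟨x, .inr (hF hxF), h⟩))
        · refine ht.2.2.2 _ h _ (hF hxF) ?_
          rw [add_assoc, parityVector_add_self]
      have hsub : E ∪ F ⊆ rootSums l ∪ rootSums r := union_subset_union hE hF
      refine ⟨insert (unit j) ((E ∪ F).image (unit j + ·)), ?_, ?_, ?_⟩
      · exact insert_subset_insert _ (image_subset_image hsub)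
      · rw [card_insert_of_notMem, card_image_of_injective _ (add_right_injective _),
          card_union_of_disjoint hdisj]
        · rw [monoRank]
          split_ifs with h
          · rw [pow_succ]
            have := h.2 ▸ hFcard
            omega
          · rcases max_choice (monoRank j l) (monoRank j r) with h | h <;> rw [h] <;> omega
        · simp only [mem_image, not_exists, not_and, add_eq_left]
          rintro x hx rfl
          exact (mem_union.1 (hsub hx)).elim ht.1.zero_notMem ht.2.1.zero_notMem
      · intro x hx
        rcases mem_insert.1 hx with rfl | hx
        · exact .inl (parityVector_add_self _)
        · obtain ⟨y, hy, rfl⟩ := mem_image.1 hx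
          refine .inr (shift y ?_)
          rcases mem_union.1 hy with hy | hy
          · exact (hEi y hy).imp_right .inl
          · exact (hFi y hy).imp_right .inr
    · have hrank : monoRank i (.node j l r) = max (monoRank i l) (monoRank i r) := by
        simp [monoRank, hji]
      rcases max_choice (monoRank i l) (monoRank i r) with h | h
      · refine ⟨E.image (unit j + ·), ?_, ?_, ?_⟩
        · intro x hx
          obtain ⟨y, hy, rfl⟩ := mem_image.1 hx
          exact mem_rootSums_node.2 (.inr ⟨y, .inl (hE hy), rfl⟩)
        · rwa [hrank, h, card_image_of_injective _ (add_right_injective _)]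
        · intro x hx
          obtain ⟨y, hy, rfl⟩ := mem_image.1 hx
          exact .inr (shift y ((hEi y hy).imp_right .inl))
      · refine ⟨F.image (unit j + ·), ?_, ?_, ?_⟩
        · intro x hx
          obtain ⟨y, hy, rfl⟩ := mem_image.1 hx
          exact mem_rootSums_node.2 (.inr ⟨y, .inr (hF hy), rfl⟩)
        · rwa [hrank, h, card_image_of_injective _ (add_right_injective _)]
        · intro x hx
          obtain ⟨y, hy, rfl⟩ := mem_image.1 hx
          exact .inr (shift y ((hFi y hy).imp_right .inr))

theorem monoRank_le (i : Fin k) {t : BinaryTree (Fin k)} (ht : IsParity t) :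
    monoRank i t ≤ k := by
  obtain ⟨E, hE, hcard, -⟩ := exists_mono_subset i t ht
  refine (Nat.pow_le_pow_iff_right (le_refl 2)).1 ?_
  have := card_le_card hE
  have := card_rootSums_lt ht
  omega

/-! ### Counting nodes by root vectors and ranks -/

theorem pow_add_pow_le {a b d p q s : ℕ} (ha : a ≤ d) (hb : b ≤ d) (hd : 1 ≤ d)
    (hp : p ≤ s) (hq : q ≤ s) (h : p < s ∨ q < s) : a ^ p + b ^ q ≤ (d + 1) ^ s := by
  have ha' : a ^ p ≤ d ^ p := Nat.pow_le_pow_left ha p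
  have hb' : b ^ q ≤ d ^ q := Nat.pow_le_pow_left hb q
  obtain ⟨s, rfl⟩ : ∃ u, s = u + 1 := ⟨s - 1, by omega⟩
  have hs : d ^ (s + 1) + d ^ s ≤ (d + 1) ^ (s + 1) := by
    calc d ^ (s + 1) + d ^ s = d ^ s * (d + 1) := by ring
      _ ≤ (d + 1) ^ s * (d + 1) := by gcongr; omega
      _ = (d + 1) ^ (s + 1) := by ring
  have hp' : d ^ p ≤ d ^ (s + 1) := Nat.pow_le_pow_right hd hp
  have hq' : d ^ q ≤ d ^ (s + 1) := Nat.pow_le_pow_right hd hq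
  rcases h with h | h
  · have : d ^ p ≤ d ^ s := Nat.pow_le_pow_right hd (by omega)
    omega
  · have : d ^ q ≤ d ^ s := Nat.pow_le_pow_right hd (by omega)
    omega

/-- The base drops by at least one at both children and the exponent at one of them at least, so `d
^ s + d ^ (s - 1) ≤ (d + 1) ^ s` closes the induction. -/
theorem numNodes_succ_le_pow (t : BinaryTree (Fin k)) (ht : IsParity t) :
    t.numNodes + 1 ≤ (#(rootSums t) + 1) ^ ∑ i, monoRank i t := by
  induction t with
  | nil => simp [BinaryTree.numNodes, monoRank]
  | node j l r ihl ihr =>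
    have hl := ihl ht.1
    have hr := ihr ht.2.1
    have hcard := card_rootSums_node ht
    have hL : #(rootSums l) ≤ #(rootSums l ∪ rootSums r) := card_le_card subset_union_left
    have hR : #(rootSums r) ≤ #(rootSums l ∪ rootSums r) := card_le_card subset_union_right
    have key := pow_add_pow_le (a := #(rootSums l) + 1) (b := #(rootSums r) + 1)
      (d := #(rootSums (.node j l r))) (by omega) (by omega) (by omega)
      (sum_le_sum fun i (_ : i ∈ univ) ↦ monoRank_left_le i j l r)
      (sum_le_sum fun i (_ : i ∈ univ) ↦ monoRank_right_le i j l r)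
      ((monoRank_root_lt j l r).imp
        (fun h ↦ sum_lt_sum (fun i _ ↦ monoRank_left_le i j l r) ⟨j, mem_univ j, h⟩)
        (fun h ↦ sum_lt_sum (fun i _ ↦ monoRank_right_le i j l r) ⟨j, mem_univ j, h⟩))
    simp only [BinaryTree.numNodes]
    omega

theorem numNodes_lt {t : BinaryTree (Fin k)} (ht : IsParity t) :
    t.numNodes < 2 ^ k ^ 3 := by
  have hsum : ∑ i, monoRank i t ≤ k * k := by
    simpa using sum_le_card_nsmul univ (fun i ↦ monoRank i t) k fun i _ ↦ monoRank_le i ht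
  calc t.numNodes + 1 ≤ (#(rootSums t) + 1) ^ ∑ i, monoRank i t := numNodes_succ_le_pow t ht
    _ ≤ (2 ^ k) ^ ∑ i, monoRank i t := Nat.pow_le_pow_left (card_rootSums_lt ht) _
    _ ≤ (2 ^ k) ^ (k * k) := Nat.pow_le_pow_right (by positivity) hsum
    _ = 2 ^ k ^ 3 := by rw [← pow_mul]; ring_nf

end BinaryTree

/-! ### From graphs to coloured binary trees -/

section Graph

variable {V : Type*} {G : SimpleGraph V} {k : ℕ} {c : V → Fin k}

/-- The parity vector of a list of colours. -/
def paritySum (L : List (Fin k)) : Fin k → ZMod 2 := (L.map unit).sum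

theorem paritySum_apply (L : List (Fin k)) (i : Fin k) : paritySum L i = (L.count i : ZMod 2) := by
  induction L with
  | nil => simp [paritySum]
  | cons j L ih =>
    simp only [paritySum, List.map_cons, List.sum_cons, Pi.add_apply] at ih ⊢
    rw [ih, List.count_cons]
    by_cases h : j = i
    · subst h; simp [unit, add_comm]
    · simp [unit, h]

/-- The parity vector of a walk. -/
def walkSum (c : V → Fin k) {u v : V} (p : G.Walk u v) : Fin k → ZMod 2 :=
  paritySum (p.support.map c)

theorem walkSum_cons {u v w : V} (h : G.Adj u v) (p : G.Walk v w) :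
    walkSum c (p.cons h) = unit (c u) + walkSum c p := by
  simp [walkSum, paritySum]

theorem walkSum_reverse_append {u v w z : V} (h : G.Adj v u) (h' : G.Adj v w)
    (p : G.Walk u z) {y : V} (q : G.Walk w y) :
    walkSum c (p.reverse.append ((q.cons h').cons h.symm)) =
      walkSum c p + unit (c v) + walkSum c q := by
  simp [walkSum, paritySum, SimpleGraph.Walk.support_append, List.sum_reverse, add_assoc]

theorem walkSum_ne_zero (hc : IsParityVertexColouring G c) {u v : V} {p : G.Walk u v}
    (hp : p.IsPath) : walkSum c p ≠ 0 := by
  obtain ⟨i, hi⟩ := hc u v p hp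
  intro h
  have := congrFun h i
  rw [walkSum, paritySum_apply, Pi.zero_apply, ZMod.natCast_eq_zero_iff_even] at this
  exact (Nat.not_even_iff_odd.2 hi) this

/-- In an acyclic graph, paths that leave `v` through different neighbours do not meet. -/
theorem isPath_reverse_append (hG : G.IsAcyclic) {v a b y z : V} (ha : G.Adj v a)
    (hb : G.Adj v b) (hab : a ≠ b) {p : G.Walk a y} {q : G.Walk b z} (hp : p.IsPath)
    (hq : q.IsPath) (hvp : v ∉ p.support) (hvq : v ∉ q.support) :
    (p.reverse.append ((q.cons hb).cons ha.symm)).IsPath := by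
  classical
  have hdisj : ∀ x ∈ p.support, x ∉ q.support := by
    intro x hxp hxq
    have h1 : ((p.takeUntil x hxp).cons ha).IsPath :=
      (hp.takeUntil hxp).cons fun h ↦ hvp (p.support_takeUntil_subset_support hxp h)
    have h2 : ((q.takeUntil x hxq).cons hb).IsPath :=
      (hq.takeUntil hxq).cons fun h ↦ hvq (q.support_takeUntil_subset_support hxq h)
    -- Both paths from `v` to `x` coincide, so their second vertices `a` and `b` do too.
    have h := congrArg (fun w ↦ w.1.snd) ((hG.subsingleton_path v x).elim ⟨_, h1⟩ ⟨_, h2⟩)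
    exact hab (by simpa using h)
  rw [SimpleGraph.Walk.isPath_def, SimpleGraph.Walk.support_append]
  simp only [SimpleGraph.Walk.support_reverse, SimpleGraph.Walk.support_cons, List.tail_cons]
  rw [List.nodup_append']
  refine ⟨List.nodup_reverse.2 hp.support_nodup, List.nodup_cons.2 ⟨hvq, hq.support_nodup⟩, ?_⟩
  intro x hx hx'
  rw [List.mem_reverse] at hx
  rcases List.mem_cons.1 hx' with rfl | hx'
  · exact hvp hx
  · exact hdisj x hx hx'

/-- The part of an acyclic graph that is reached from `v` by paths of length less than `m` with
second vertex in `Q`, as a coloured binary tree. -/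
theorem exists_isParity_tree (hG : G.IsAcyclic) (hdeg : ∀ v, (G.neighborSet v).encard ≤ 3)
    (hc : IsParityVertexColouring G c) (m : ℕ) :
    ∀ (v : V) (Q : Set V), Q ⊆ G.neighborSet v → Q.encard ≤ 2 →
      ∃ (t : BinaryTree (Fin k)) (S : Finset V), IsParity t ∧ #S ≤ t.numNodes ∧
        (∀ (w : V) (q : G.Walk v w), q.IsPath → q.length < m →
          (∀ x ∈ q.support, G.Adj v x → x ∈ Q) → w ∈ S) ∧
        ∀ d ∈ rootSums t, ∃ (w : V) (q : G.Walk v w), q.IsPath ∧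
          (∀ x ∈ q.support, G.Adj v x → x ∈ Q) ∧ walkSum c q = d := by
  classical
  induction m with
  | zero => exact fun v Q _ _ ↦ ⟨.nil, ∅, by simp [IsParity, rootSums]⟩
  | succ m ih =>
    intro v Q hQ hQcard
    -- `R` holds at most one child, so that a missing child becomes `.nil`.
    have child (R : Set V) (hRQ : R ⊆ Q) (hR : R.Subsingleton) :
        ∃ (t : BinaryTree (Fin k)) (S : Finset V), IsParity t ∧ #S ≤ t.numNodes ∧
          (∀ a ∈ R, ∀ (w : V) (q : G.Walk a w), q.IsPath → q.length < m → v ∉ q.support → w ∈ S) ∧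
          ∀ d ∈ rootSums t, ∃ a ∈ R, ∃ (w : V) (q : G.Walk a w), q.IsPath ∧
            v ∉ q.support ∧ walkSum c q = d := by
      rcases hR.eq_empty_or_singleton with rfl | ⟨a, rfl⟩
      · exact ⟨.nil, ∅, by simp [IsParity, rootSums]⟩
      · have hva : G.Adj v a := hQ (hRQ rfl)
        have hcard : (G.neighborSet a \ {v}).encard ≤ 2 := by
          have h := Set.encard_sdiff_singleton_add_one (s := G.neighborSet a) hva.symm
          have h3 := hdeg a
          rw [← h, show (3 : ℕ∞) = 2 + 1 by norm_num] at h3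
          exact (ENat.add_le_add_iff_right ENat.one_ne_top).1 h3
        obtain ⟨t, S, ht, hS, hcov, hsum⟩ := ih a _ Set.sdiff_subset hcard
        refine ⟨t, S, ht, hS, ?_, ?_⟩
        · rintro _ rfl w q hq hlen hv
          exact hcov w q hq hlen fun x hx hax ↦ ⟨hax, fun h ↦ hv (h ▸ hx)⟩
        · intro d hd
          obtain ⟨w, q, hq, hqs, rfl⟩ := hsum d hd
          exact ⟨a, rfl, w, q, hq, fun hv ↦ (hqs v hv hva.symm).2 rfl, rfl⟩
    obtain ⟨R₁, R₂, h₁, h₂, hQ', hR⟩ : ∃ R₁ R₂ : Set V, R₁.Subsingleton ∧ R₂.Subsingleton ∧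
        Q = R₁ ∪ R₂ ∧ Disjoint R₁ R₂ := by
      rcases Q.eq_empty_or_nonempty with rfl | ⟨a, ha⟩
      · exact ⟨∅, ∅, by simp⟩
      · refine ⟨{a}, Q \ {a}, Set.subsingleton_singleton, ?_, ?_, Set.disjoint_sdiff_right⟩
        · rw [← Set.encard_le_one_iff_subsingleton]
          have h := Set.encard_sdiff_singleton_add_one ha
          rw [← h, show (2 : ℕ∞) = 1 + 1 by norm_num] at hQcard
          exact (ENat.add_le_add_iff_right ENat.one_ne_top).1 hQcard
        · rw [Set.union_sdiff_self, Set.union_eq_right.2 (by simpa using ha)]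
    obtain ⟨t₁, S₁, ht₁, hS₁, hcov₁, hsum₁⟩ := child R₁ (hQ' ▸ Set.subset_union_left) h₁
    obtain ⟨t₂, S₂, ht₂, hS₂, hcov₂, hsum₂⟩ := child R₂ (hQ' ▸ Set.subset_union_right) h₂
    have hsum (d) (hd : d ∈ rootSums (.node (c v) t₁ t₂)) :
        ∃ (w : V) (q : G.Walk v w), q.IsPath ∧
          (∀ x ∈ q.support, G.Adj v x → x ∈ Q) ∧ walkSum c q = d := by
      rcases mem_rootSums_node.1 hd with rfl | ⟨y, hy, rfl⟩
      · exact ⟨v, .nil, by simp, by simp, by simp [walkSum, paritySum]⟩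
      · obtain ⟨a, ha, w, q, hq, hv, rfl⟩ : ∃ a ∈ Q, ∃ (w : V) (q : G.Walk a w), q.IsPath ∧
            v ∉ q.support ∧ walkSum c q = y := by
          rcases hy with hy | hy
          · obtain ⟨a, ha, h⟩ := hsum₁ y hy
            exact ⟨a, hQ' ▸ .inl ha, h⟩
          · obtain ⟨a, ha, h⟩ := hsum₂ y hy
            exact ⟨a, hQ' ▸ .inr ha, h⟩
        have hpath : (q.cons (hQ ha)).IsPath := hq.cons hv
        refine ⟨w, q.cons (hQ ha), hpath, fun x hx hvx ↦ ?_, walkSum_cons _ _⟩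
        -- By acyclicity, the only neighbour of `v` on a path from `v` is its second vertex.
        have := hG.eq_snd_of_adj_start hpath hvx hx
        exact (this.trans q.getVert_zero) ▸ ha
    refine ⟨.node (c v) t₁ t₂, insert v (S₁ ∪ S₂), ⟨ht₁, ht₂, ?_, ?_⟩, ?_, ?_, hsum⟩
    · intro h
      obtain ⟨w, q, hq, -, h0⟩ := hsum 0 h
      exact walkSum_ne_zero hc hq h0
    · intro x hx y hy
      obtain ⟨a, ha, _, p, hp, hvp, rfl⟩ := hsum₁ x hx
      obtain ⟨b, hb, _, q, hq, hvq, rfl⟩ := hsum₂ y hy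
      have hva : G.Adj v a := hQ (hQ' ▸ .inl ha)
      have hvb : G.Adj v b := hQ (hQ' ▸ .inr hb)
      rw [← walkSum_reverse_append hva hvb]
      exact walkSum_ne_zero hc
        (isPath_reverse_append hG hva hvb (hR.ne_of_mem ha hb) hp hq hvp hvq)
    · have h1 := card_insert_le v (S₁ ∪ S₂)
      have h2 := card_union_le S₁ S₂
      simp only [BinaryTree.numNodes]
      omega
    · intro w q hq hlen hqs
      cases q with
      | nil => simp
      | @cons _ a _ hva q =>
        rw [SimpleGraph.Walk.cons_isPath_iff] at hq
        have hlen' : q.length < m := by simpa using hlen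
        have haQ : a ∈ Q := hqs a (by simp) hva
        rw [hQ'] at haQ
        rw [mem_insert, mem_union]
        rcases haQ with ha | ha
        · exact .inr (.inl (hcov₁ a ha w q hq.1 hlen' hq.2))
        · exact .inr (.inr (hcov₂ a ha w q hq.1 hlen' hq.2))

/-- Supplies the root: every other vertex loses one of its three neighbours to its parent, but the
root has no parent. -/
theorem exists_encard_neighborSet_le_two [Fintype V] (hG : G.IsTree) :
    ∃ v, (G.neighborSet v).encard ≤ 2 := by
  classical
  rcases subsingleton_or_nontrivial V with h | h
  · obtain ⟨v⟩ := hG.connected.nonempty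
    exact ⟨v, (Set.encard_le_one_iff_subsingleton.2 (Set.subsingleton_of_subsingleton)).trans
      (by norm_num)⟩
  · obtain ⟨v, hv⟩ := hG.exists_vert_degree_one_of_nontrivial
    refine ⟨v, ?_⟩
    rw [Set.encard_eq_coe_toFinset_card, ← SimpleGraph.neighborFinset_def,
      SimpleGraph.card_neighborFinset_eq_degree, hv]
    norm_num

theorem card_lt_two_pow [Fintype V] (hB : IsBinaryTree G) (hc : IsParityVertexColouring G c) :
    Fintype.card V < 2 ^ k ^ 3 := by
  classical
  obtain ⟨r, hr⟩ := exists_encard_neighborSet_le_two hB.1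
  obtain ⟨t, S, ht, hS, hcov, -⟩ :=
    exists_isParity_tree hB.1.isAcyclic hB.2 hc (Fintype.card V) r _ subset_rfl hr
  have huniv : S = univ := by
    refine eq_univ_iff_forall.2 fun w ↦ ?_
    obtain ⟨q, hq⟩ := hB.1.connected.exists_isPath r w
    exact hcov w q hq hq.length_lt fun x _ hx ↦ hx
  rw [← card_univ, ← huniv]
  exact hS.trans_lt (numNodes_lt ht)

end Graph

end ParityColouring

theorem theorem12 {V : Type*} [Fintype V] (B : SimpleGraph V) (hB : IsBinaryTree B) :
    (Real.logb 2 (Fintype.card V : ℝ)) ^ (1 / 3 : ℝ) < (parityChromaticNumber B : ℝ) := by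
  obtain ⟨c, hc⟩ := Nat.sInf_mem (exists_isParityVertexColouring B)
  have hlt := ParityColouring.card_lt_two_pow hB hc
  change Fintype.card V < 2 ^ parityChromaticNumber B ^ 3 at hlt
  have hpos : 0 < Fintype.card V := Fintype.card_pos_iff.2 hB.1.connected.nonempty
  have hlog : Real.logb 2 (Fintype.card V : ℝ) < (parityChromaticNumber B : ℝ) ^ 3 := by
    rw [Real.logb_lt_iff_lt_rpow one_lt_two (by exact_mod_cast hpos)]
    exact_mod_cast hlt
  have hnonneg : 0 ≤ Real.logb 2 (Fintype.card V : ℝ) :=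
    Real.logb_nonneg one_lt_two (by exact_mod_cast hpos)
  calc (Real.logb 2 (Fintype.card V : ℝ)) ^ (1 / 3 : ℝ)
      < ((parityChromaticNumber B : ℝ) ^ 3) ^ (1 / 3 : ℝ) :=
        Real.rpow_lt_rpow hnonneg hlog (by norm_num)
    _ = (parityChromaticNumber B : ℝ) := by
        rw [one_div]
        exact_mod_cast Real.pow_rpow_inv_natCast (Nat.cast_nonneg _) three_ne_zero
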